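/- Let $Y$ be a real normed space. A subspace $X_1\subset Y$ is called orthogonal to a subspace $X_2\subset Y$ if $\operatorname{dist}(x,X_2)=1$ for every unit vector $x\in X_1$, and $\varepsilon$-almost orthogonal to $X_2$ if $\operatorname{dist}(x,X_2)\ge 1-\varepsilon$ for every unit vector $x\in X_1$. Let $\ell^p_N$ denote $\mathbb R^N$ with the norm $(\sum_{i=1}^N|x_i|^p)^{1/p}$. (1) Let $k,m,s$ be natural numbers with $1<k\le m$ and $2s+1>m-k+2$, and put $N=2m$. Then there is a subspace $E\subset \ell^{2s+1}_{N}$ of codimension $m$ such that no $k$-dimensional subspace of $\ell^{2s+1}_{N}$ is orthogonal to $E$. (2) Let $m\ge 2$, $2s+1>m$ and $N=2m$. Then there is a single subspace $E\subset \ell^{2s+1}_{N}$ of codimension $m$ such that, for every $k=2,3,\dots,m$, no $k$-dimensional subspace of $\ell^{2s+1}_{N}$ is orthogonal to $E$. (3) Let $1\le q\le\infty$ and let $X=\bigoplus_{m=1}^\infty \ell^{2m+1}_{2m}$ be the $\ell^q$-direct sum. Then there are finite-dimensional subspaces $E_m\subset F_m\subset X$ ($m=1,2,\dots$), where $F_m$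 can be taken to be the $m$-th summand $\ell^{2m+1}_{2m}$, with $\dim F_m-\dim E_m=m$, and numbers $\varepsilon_m>0$ with $\varepsilon_m\to0$, such that for every $m$ no subspace $K_m\subset F_m$ with $\dim K_m\ge 2$ is $\varepsilon_m$-almost orthogonal to $E_m$; that is, every such $K_m$ contains a unit vector whose distance to $E_m$ is less than $1-\varepsilon_m$. -/

import Mathlib

open Filter Topology
open scoped ENNReal

/-- `X₁` is orthogonal to `X₂`: every unit vector of `X₁` has distance `1` to `X₂`. -/
def IsOrthogonalTo {Y : Type*} [NormedAddCommGroup Y] [NormedSpace ℝ Y]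
    (X₁ X₂ : Submodule ℝ Y) : Prop :=
  ∀ x ∈ X₁, ‖x‖ = 1 → Metric.infDist x (X₂ : Set Y) = 1

/-- `X₁` is `ε`-almost orthogonal to `X₂`: every unit vector of `X₁` has distance at least
`1 - ε` to `X₂`. -/
def IsAlmostOrthogonalTo {Y : Type*} [NormedAddCommGroup Y] [NormedSpace ℝ Y]
    (ε : ℝ) (X₁ X₂ : Submodule ℝ Y) : Prop :=
  ∀ x ∈ X₁, ‖x‖ = 1 → 1 - ε ≤ Metric.infDist x (X₂ : Set Y)

instance fact_one_le_odd (s : ℕ) : Fact ((1 : ℝ≥0∞) ≤ ((2 * s + 1 : ℕ) : ℝ≥0∞)) :=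
  ⟨by exact_mod_cast Nat.le_add_left 1 (2 * s)⟩

/-- The real space `ℓ^{2s+1}_N`, that is `ℝ^N` with the norm `(∑ |xᵢ|^{2s+1})^{1/(2s+1)}`. -/
abbrev OddEll (s N : ℕ) : Type :=
  PiLp ((2 * s + 1 : ℕ) : ℝ≥0∞) (fun _ : Fin N => ℝ)

/-- The `ℓ^q`-direct sum over `m ≥ 1` of the spaces `ℓ^{2m+1}_{2m}`. -/
abbrev OddEllSum (q : ℝ≥0∞) : Type :=
  lp (fun m : ℕ+ => OddEll (m : ℕ) (2 * (m : ℕ))) q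

/-- The `m`-th summand `ℓ^{2m+1}_{2m}`, as a subspace of the direct sum. -/
noncomputable def oddEllSummand (q : ℝ≥0∞) [Fact (1 ≤ q)] (m : ℕ+) :
    Submodule ℝ (OddEllSum q) :=
  LinearMap.range
    (lp.lsingle (𝕜 := ℝ) (E := fun m : ℕ+ => OddEll (m : ℕ) (2 * (m : ℕ))) q m)

/-!
The idea.  Write `p = 2s + 1` with `s ≥ 1`, and let `σ t = sign t * t ^ (2s)`.  Up to the factor `p`,
`σ` is the derivative of `|t| ^ p`, so a vector `x` of `ℓ^p_N` is orthogonal to `E` only if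
`∑ eᵢ σ(xᵢ) = 0` for every `e ∈ E`.

Suppose that `u, v` are linearly independent and that this relation holds for all vectors
`a u + b v`.  Restricting it to a line `z + t w` of the plane, the terms with `zᵢ ≠ 0` are polynomials
in `t` near `t = 0`, because the exponent `2s` is even, whereas the terms with `zᵢ = 0` add up to
a multiple of `σ t`, which is not a polynomial near `0`.  Hence the terms with `zᵢ = 0` cancel by
themselves (`sum_sgnPow_eq_zero_of_line`).  Choosing the line through the zero set of one
coordinate form, one obtains for every coordinate `i` with `(uᵢ, vᵢ) ≠ 0` a nonzero vector that
annihilates `E` and is supported on the coordinates `j` with `(uⱼ, vⱼ)` proportional to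
`(uᵢ, vᵢ)`.  Since `u, v` are independent there are two such classes of proportional coordinates,
they are disjoint, and one of them has at most `N / 2` elements.

So it is enough that no nonzero vector with at most `m = N / 2` nonzero entries annihilates `E`.
This holds for the space `polyEvalSubspace` of all vectors `(q(0), …, q(N-1))` with `q` a polynomial
of degree less than `m`: testing against the polynomial that vanishes on all points of the support
but one shows that the entry at this point is zero.

The almost orthogonal version follows by compactness
(`exists_pos_forall_not_isAlmostOrthogonalTo`): planes that are `ε`-almost orthogonal with `ε → 0`
have unit bases which stay uniformly independent, and a limit of these spans an orthogonal plane.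
-/

/-! ### Orthogonality as a family of norm inequalities -/

section Orthogonality

variable {Y : Type*} [NormedAddCommGroup Y] [NormedSpace ℝ Y]

lemma isAlmostOrthogonalTo_iff {ε : ℝ} {L E : Submodule ℝ Y} :
    IsAlmostOrthogonalTo ε L E ↔ ∀ x ∈ L, ∀ e ∈ E, (1 - ε) * ‖x‖ ≤ ‖x - e‖ := by
  constructor
  · intro h x hx e he
    rcases eq_or_ne x 0 with rfl | hx0
    · simp
    have hpos : 0 < ‖x‖ := norm_pos_iff.2 hx0
    have h1 := h (‖x‖⁻¹ • x) (L.smul_mem _ hx) (by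
      rw [norm_smul, norm_inv, norm_norm, inv_mul_cancel₀ hpos.ne'])
    have h2 := Metric.infDist_le_dist_of_mem (x := ‖x‖⁻¹ • x)
      (show ‖x‖⁻¹ • e ∈ (E : Set Y) from E.smul_mem _ he)
    rw [dist_eq_norm, ← smul_sub, norm_smul, norm_inv, norm_norm] at h2
    have h3 := h1.trans h2
    rwa [inv_mul_eq_div, le_div_iff₀ hpos] at h3
  · intro h x hx hx1
    refine (Metric.le_infDist ⟨0, E.zero_mem⟩).2 fun e he => ?_
    simpa [hx1, dist_eq_norm] using h x hx e he

lemma isOrthogonalTo_iff {L E : Submodule ℝ Y} :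
    IsOrthogonalTo L E ↔ ∀ x ∈ L, ∀ e ∈ E, ‖x‖ ≤ ‖x - e‖ := by
  have h0 : IsOrthogonalTo L E ↔ IsAlmostOrthogonalTo 0 L E := by
    refine forall₃_congr fun x _ hx1 => ?_
    have hle : Metric.infDist x (E : Set Y) ≤ 1 := by
      simpa [hx1] using Metric.infDist_le_dist_of_mem (x := x) E.zero_mem
    rw [sub_zero]
    exact ⟨fun h => h.ge, fun h => le_antisymm hle h⟩
  simp only [h0, isAlmostOrthogonalTo_iff, sub_zero, one_mul]

lemma IsAlmostOrthogonalTo.mono {ε δ : ℝ} (hεδ : ε ≤ δ) {L E : Submodule ℝ Y}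
    (h : IsAlmostOrthogonalTo ε L E) : IsAlmostOrthogonalTo δ L E :=
  fun x hx hx1 => (sub_le_sub_left hεδ 1).trans (h x hx hx1)

/-- Almost orthogonality only depends on the norm, so its failure in dimension at least two is
preserved by isometric embeddings. -/
lemma not_isAlmostOrthogonalTo_map [FiniteDimensional ℝ Y] {Z : Type*} [NormedAddCommGroup Z] [NormedSpace ℝ Z]
    {f : Y →ₗ[ℝ] Z} (hf : ∀ y, ‖f y‖ = ‖y‖) {ε : ℝ} {E : Submodule ℝ Y}
    (h : ∀ K : Submodule ℝ Y, 2 ≤ Module.finrank ℝ K → ¬ IsAlmostOrthogonalTo ε K E)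
    {K : Submodule ℝ Z} (hKf : K ≤ LinearMap.range f) (hK : 2 ≤ Module.finrank ℝ K) :
    ¬ IsAlmostOrthogonalTo ε K (E.map f) := by
  intro hKE
  have hmap : (K.comap f).map f = K := by rw [Submodule.map_comap_eq, inf_eq_right.2 hKf]
  refine h (K.comap f) ?_ (isAlmostOrthogonalTo_iff.2 fun x hx e he => ?_)
  · calc 2 ≤ Module.finrank ℝ ((K.comap f).map f) := by rwa [hmap]
      _ ≤ Module.finrank ℝ (K.comap f) := Submodule.finrank_map_le f _
  · simpa only [← map_sub, hf] using
      isAlmostOrthogonalTo_iff.1 hKE (f x) hx (f e) (Submodule.mem_map_of_mem he)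

/-- A subspace of dimension at least two has a pair of unit vectors that is independent in
a quantitative way. -/
lemma exists_unit_pair_of_two_le_finrank (K : Submodule ℝ Y)
    (hK : 2 ≤ Module.finrank ℝ K) :
    ∃ u ∈ K, ∃ v ∈ K, ‖u‖ = 1 ∧ ‖v‖ = 1 ∧ ∀ t : ℝ, 1 / 2 ≤ ‖v - t • u‖ := by
  have : Nontrivial K := Module.nontrivial_of_finrank_pos (R := ℝ) (by omega)
  obtain ⟨u, hu⟩ := exists_norm_eq K zero_le_one
  have hne : ∃ x : K, x ∉ ℝ ∙ u := by
    by_contra! hall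
    have htop : (ℝ ∙ u) = ⊤ := (Submodule.eq_top_iff').2 hall
    have h1 := finrank_span_singleton (K := ℝ) (v := u) (by rintro rfl; simp at hu)
    rw [htop, finrank_top] at h1
    omega
  obtain ⟨v, -, hv1, hv⟩ := riesz_lemma_of_lt_one (𝕜 := ℝ)
    (Submodule.closed_of_finiteDimensional (ℝ ∙ u)) hne (r := 1 / 2) (by norm_num)
  exact ⟨u, u.2, v, v.2, hu, hv1, fun t => hv (t • u) (Submodule.mem_span_singleton.2 ⟨t, rfl⟩)⟩

lemma linearIndependent_pair_of_le_norm_sub {u v : Y} (hu : ‖u‖ = 1)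
    (huv : ∀ t : ℝ, 1 / 2 ≤ ‖v - t • u‖) : LinearIndependent ℝ ![u, v] := by
  refine (LinearIndependent.pair_iff' (by rintro rfl; simp at hu)).2 fun t ht => ?_
  have := huv t
  rw [ht, sub_self, norm_zero] at this
  norm_num at this

/-- If no plane is orthogonal to `E`, then by compactness there is a uniform `ε > 0` such that no
subspace of dimension at least two is `ε`-almost orthogonal to `E`. -/
theorem exists_pos_forall_not_isAlmostOrthogonalTo [FiniteDimensional ℝ Y] (E : Submodule ℝ Y)
    (hE : ∀ L : Submodule ℝ Y, 2 ≤ Module.finrank ℝ L → ¬ IsOrthogonalTo L E) :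
    ∃ ε : ℝ, 0 < ε ∧
      ∀ K : Submodule ℝ Y, 2 ≤ Module.finrank ℝ K → ¬ IsAlmostOrthogonalTo ε K E := by
  have : ProperSpace Y := FiniteDimensional.proper ℝ Y
  by_contra! hcon
  choose K hK2 hKE using fun n : ℕ => hcon (1 / ((n : ℝ) + 1)) Nat.one_div_pos_of_nat
  choose u huK v hvK hu hv huv using fun n => exists_unit_pair_of_two_le_finrank (K n) (hK2 n)
  -- Passing to a subsequence, the unit pairs converge.
  obtain ⟨⟨a, b⟩, -, φ, hφ, hlim⟩ :=
    ((isCompact_sphere (0 : Y) 1).prod (isCompact_sphere (0 : Y) 1)).tendsto_subseq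
      (x := fun n => (u n, v n)) fun n => ⟨by simpa using hu n, by simpa using hv n⟩
  have hua : Tendsto (fun n => u (φ n)) atTop (𝓝 a) := hlim.fst_nhds
  have hvb : Tendsto (fun n => v (φ n)) atTop (𝓝 b) := hlim.snd_nhds
  have ha : ‖a‖ = 1 := tendsto_nhds_unique hua.norm (by simp [hu])
  have hab : ∀ t : ℝ, 1 / 2 ≤ ‖b - t • a‖ := fun t =>
    ge_of_tendsto' (hvb.sub (hua.const_smul t)).norm fun n => huv (φ n) t
  have hind := linearIndependent_pair_of_le_norm_sub ha hab
  have hrank : Module.finrank ℝ (Submodule.span ℝ {a, b}) = 2 := by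
    rw [← Matrix.range_cons_cons_empty a b ![], finrank_span_eq_card hind, Fintype.card_fin]
  refine hE (Submodule.span ℝ {a, b}) hrank.ge (isOrthogonalTo_iff.2 fun x hx e he => ?_)
  obtain ⟨r, t, rfl⟩ := Submodule.mem_span_pair.1 hx
  have hx : Tendsto (fun n => r • u (φ n) + t • v (φ n)) atTop (𝓝 (r • a + t • b)) :=
    (hua.const_smul r).add (hvb.const_smul t)
  have hε : Tendsto (fun n => 1 - 1 / ((φ n : ℝ) + 1)) atTop (𝓝 (1 - 0)) :=
    tendsto_const_nhds.sub (tendsto_one_div_add_atTop_nhds_zero_nat.comp hφ.tendsto_atTop)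
  have := le_of_tendsto_of_tendsto' (hε.mul hx.norm) (hx.sub_const e).norm fun n =>
    isAlmostOrthogonalTo_iff.1 (hKE (φ n)) _
      ((K (φ n)).add_mem ((K (φ n)).smul_mem r (huK _)) ((K (φ n)).smul_mem t (hvK _))) e he
  simpa using this

end Orthogonality

/-! ### The signed even power -/

/-- The signed power `sign t * t ^ (2s)`, which is the derivative of `|t| ^ (2s + 1)` up to the
factor `2s + 1`. -/
noncomputable def sgnPow (s : ℕ) (t : ℝ) : ℝ := (SignType.sign t : ℝ) * t ^ (2 * s)

lemma sgnPow_mul (s : ℕ) (a b : ℝ) : sgnPow s (a * b) = sgnPow s a * sgnPow s b := by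
  simp only [sgnPow, sign_mul, SignType.coe_mul, mul_pow]
  ring

lemma sgnPow_ne_zero (s : ℕ) {a : ℝ} (ha : a ≠ 0) : sgnPow s a ≠ 0 := by
  refine mul_ne_zero ?_ (pow_ne_zero _ ha)
  rcases ha.lt_or_gt with h | h <;> simp [h]

lemma hasDerivAt_abs_pow_odd {s : ℕ} (hs : s ≠ 0) (x : ℝ) :
    HasDerivAt (fun x : ℝ => |x| ^ (2 * s + 1)) ((2 * s + 1 : ℕ) * sgnPow s x) x := by
  have hp : (1 : ℝ) < ((2 * s + 1 : ℕ) : ℝ) := by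
    exact_mod_cast (by omega : 1 < 2 * s + 1)
  have h := hasDerivAt_abs_rpow x hp
  simp only [Real.rpow_natCast] at h
  convert h using 1
  have hexp : ((2 * s + 1 : ℕ) : ℝ) - 2 = ((2 * s - 1 : ℕ) : ℝ) := by
    rw [Nat.cast_sub (by omega)]
    push_cast
    ring
  have hx2 : x ^ (2 * s) = |x| ^ (2 * s - 1) * |x| := by
    rw [← pow_succ, Nat.sub_add_cancel (by omega), (even_two_mul s).pow_abs]
  rw [hexp, Real.rpow_natCast, sgnPow, hx2]
  conv_rhs => rw [← sign_mul_abs x]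
  simp only [abs_mul, abs_abs]
  rcases eq_or_ne x 0 with rfl | hx
  · simp
  have h1 : |(SignType.sign x : ℝ)| = 1 := by
    rcases hx.lt_or_gt with h | h <;> simp [h]
  rw [h1]
  ring

/-- A linear relation between signed powers along a line splits off the terms that are singular
at the parameter value zero: all other terms are polynomials near zero, while the singular terms
sum up to a multiple of `sign t * t ^ (2s)`. -/
lemma sum_sgnPow_eq_zero_of_line {ι : Type*} [Fintype ι] (s : ℕ) (e z w : ι → ℝ)
    (h : ∀ t : ℝ, ∑ i, e i * sgnPow s (z i + t * w i) = 0) :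
    ∑ i with z i = 0, e i * sgnPow s (w i) = 0 := by
  set c : ℝ := ∑ i with z i = 0, e i * sgnPow s (w i) with hc
  -- The regular part of the relation near `0`, where the signs are those at `t = 0`.
  let P : Polynomial ℝ := ∑ i with z i ≠ 0, Polynomial.C (e i * (SignType.sign (z i) : ℝ)) *
    (Polynomial.C (z i) + Polynomial.X * Polynomial.C (w i)) ^ (2 * s)
  have hsign : ∀ᶠ t : ℝ in 𝓝 0, ∀ i, z i ≠ 0 →
      SignType.sign (z i + t * w i) = SignType.sign (z i) := by
    refine eventually_all.2 fun i => ?_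
    by_cases hi : z i = 0
    · simp [hi]
    have hcont : Tendsto (fun t : ℝ => z i + t * w i) (𝓝 0) (𝓝 (z i)) := by
      have : Continuous fun t : ℝ => z i + t * w i := by fun_prop
      simpa using this.tendsto 0
    have := (continuousAt_sign_of_ne_zero hi).tendsto.comp hcont
    rw [nhds_discrete SignType, tendsto_pure] at this
    filter_upwards [this] with t ht _ using ht
  have hP : ∀ᶠ t : ℝ in 𝓝 0, sgnPow s t * c + P.eval t = 0 := by
    filter_upwards [hsign] with t ht
    rw [← h t, ← Finset.sum_filter_add_sum_filter_not Finset.univ (fun i => z i = 0)]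
    congr 1
    · rw [hc, Finset.mul_sum]
      refine Finset.sum_congr rfl fun i hi => ?_
      rw [(Finset.mem_filter.1 hi).2, zero_add, sgnPow_mul]
      ring
    · simp only [P, Polynomial.eval_finsetSum]
      refine Finset.sum_congr rfl fun i hi => ?_
      rw [sgnPow, ht i (Finset.mem_filter.1 hi).2]
      simp [mul_assoc, mul_comm t]
  obtain ⟨δ, hδ, hball⟩ := Metric.eventually_nhds_iff.1 hP
  -- For `t > 0` the relation is polynomial, hence holds identically.
  have hpos : P + Polynomial.C c * Polynomial.X ^ (2 * s) = 0 := by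
    refine Polynomial.eq_zero_of_infinite_isRoot _
      ((Set.Ioo_infinite hδ).mono fun t ht => ?_)
    have h1 := hball (y := t) (by simpa [abs_of_pos ht.1] using ht.2)
    rw [sgnPow, sign_pos ht.1] at h1
    simp only [Set.mem_ofPred_eq, Polynomial.IsRoot.def, Polynomial.eval_add, Polynomial.eval_mul,
      Polynomial.eval_C, Polynomial.eval_pow, Polynomial.eval_X]
    simp only [SignType.coe_one] at h1
    linarith
  -- At a negative parameter the singular part changes its sign, the polynomial identity does not.
  have h1 := hball (y := -(δ / 2)) (by simpa [abs_of_pos hδ] using hδ)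
  have h2 := congrArg (Polynomial.eval (-(δ / 2))) hpos
  simp only [Polynomial.eval_add, Polynomial.eval_mul, Polynomial.eval_C, Polynomial.eval_pow,
    Polynomial.eval_X, Polynomial.eval_zero] at h2
  rw [sgnPow, sign_neg (by linarith)] at h1
  simp only [SignType.coe_neg_one] at h1
  have h3 : (-(δ / 2)) ^ (2 * s) * c = 0 := by linarith
  exact (mul_eq_zero.1 h3).resolve_left (pow_ne_zero _ (by linarith))

/-! ### Annihilators of small support -/

/-- If all vectors of the plane spanned by `u` and `v` satisfy the signed power relations given by
`E`, and no nonzero vector with at most `m` nonzero entries annihilates `E`, then `u` and `v` are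
proportional. -/
lemma mul_eq_mul_of_sgnPow_relations {m s : ℕ} (E : Set (Fin (2 * m) → ℝ))
    (hE : ∀ c : Fin (2 * m) → ℝ, (∀ e ∈ E, ∑ i, e i * c i = 0) →
      (Finset.univ.filter fun i => c i ≠ 0).card ≤ m → c = 0)
    (u v : Fin (2 * m) → ℝ)
    (h : ∀ e ∈ E, ∀ a b : ℝ, ∑ i, e i * sgnPow s (a * u i + b * v i) = 0)
    (i j : Fin (2 * m)) : u i * v j = u j * v i := by
  by_contra hij
  -- The nonzero coordinate forms proportional to the form `k`.
  let S : Fin (2 * m) → Finset (Fin (2 * m)) := fun k =>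
    Finset.univ.filter fun l => u k * v l = u l * v k ∧ (u l ≠ 0 ∨ v l ≠ 0)
  have key : ∀ k, (u k ≠ 0 ∨ v k ≠ 0) → m < (S k).card := by
    intro k hk
    by_contra! hcard
    -- The line through the zero `(-v k, u k)` of the form `k`, in the direction orthogonal to it.
    let z : Fin (2 * m) → ℝ := fun l => -(v k) * u l + u k * v l
    let w : Fin (2 * m) → ℝ := fun l => u k * u l + v k * v l
    let c : Fin (2 * m) → ℝ := fun l => if z l = 0 then sgnPow s (w l) else 0
    have hc : c = 0 := by
      refine hE c (fun e he => ?_) (le_trans (Finset.card_le_card fun l hl => ?_) hcard)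
      · have := sum_sgnPow_eq_zero_of_line s e z w fun t => by
          rw [← h e he (-(v k) + t * u k) (u k + t * v k)]
          refine Finset.sum_congr rfl fun l _ => ?_
          congr 2
          simp only [z, w]
          ring
        rw [Finset.sum_filter] at this
        rw [← this]
        refine Finset.sum_congr rfl fun l _ => ?_
        simp only [c, mul_ite, mul_zero]
      · have hl' : z l = 0 := by
          by_contra hne
          simp [c, hne] at hl
        simp only [S, Finset.mem_filter, Finset.mem_univ, true_and]
        refine ⟨by simp only [z] at hl'; linarith, ?_⟩
        by_contra! hzero
        simp [c, w, hzero.1, hzero.2, sgnPow] at hl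
    have hck : c k = sgnPow s (w k) := if_pos (by simp only [z]; ring)
    have hwk : w k ≠ 0 := by
      simp only [w]
      rcases hk with hk | hk
      · nlinarith [mul_self_pos.2 hk, mul_self_nonneg (v k)]
      · nlinarith [mul_self_pos.2 hk, mul_self_nonneg (u k)]
    exact sgnPow_ne_zero s hwk (by rw [← hck, hc]; rfl)
  have hi : u i ≠ 0 ∨ v i ≠ 0 := by
    by_contra! hzero
    simp [hzero.1, hzero.2] at hij
  have hj : u j ≠ 0 ∨ v j ≠ 0 := by
    by_contra! hzero
    simp [hzero.1, hzero.2] at hij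
  have hdisj : Disjoint (S i) (S j) := by
    refine Finset.disjoint_left.2 fun l hli hlj => hij ?_
    simp only [S, Finset.mem_filter, Finset.mem_univ, true_and] at hli hlj
    rcases hli.2 with hl | hl
    · refine mul_left_cancel₀ hl ?_
      linear_combination u j * hli.1 - u i * hlj.1
    · refine mul_left_cancel₀ hl ?_
      linear_combination v j * hli.1 - v i * hlj.1
  have hle := Finset.card_le_univ (S i ∪ S j)
  rw [Finset.card_union_of_disjoint hdisj, Fintype.card_fin] at hle
  have := key i hi
  have := key j hj
  omega

/-! ### The space of polynomial values -/

/-- The vectors `(q(0), …, q(N-1))` of `ℓ^{2s+1}_N`, where `q` runs through the real polynomials of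
degree less than `m`. -/
noncomputable def polyEvalSubspace (s m N : ℕ) : Submodule ℝ (OddEll s N) :=
  LinearMap.range
    (((WithLp.linearEquiv ((2 * s + 1 : ℕ) : ℝ≥0∞) ℝ (Fin N → ℝ)).symm.toLinearMap ∘ₗ
      LinearMap.pi fun i : Fin N => Polynomial.leval (i : ℝ)).domRestrict
        (Polynomial.degreeLT ℝ m))

lemma mem_polyEvalSubspace {s m N : ℕ} {q : Polynomial ℝ} (hq : q ∈ Polynomial.degreeLT ℝ m) :
    WithLp.toLp _ (fun i : Fin N => q.eval (i : ℝ)) ∈ polyEvalSubspace s m N :=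
  ⟨⟨q, hq⟩, rfl⟩

lemma finrank_polyEvalSubspace (s : ℕ) {m N : ℕ} (hmN : m ≤ N) :
    Module.finrank ℝ (polyEvalSubspace s m N) = m := by
  rw [polyEvalSubspace, LinearMap.finrank_range_of_inj,
    (Polynomial.degreeLTEquiv ℝ m).finrank_eq, Module.finrank_fin_fun]
  refine (injective_iff_map_eq_zero _).2 fun q hq => Subtype.ext ?_
  have hroot : ∀ i : Fin N, (q : Polynomial ℝ).eval (i : ℝ) = 0 := fun i =>
    congrArg (fun x : OddEll s N => x i) hq
  refine Polynomial.eq_zero_of_degree_lt_of_eval_index_eq_zero (s := Finset.univ)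
    (v := fun i : Fin N => (i : ℝ)) (fun i _ j _ hij => ?_) ?_ fun i _ => hroot i
  · exact Fin.ext (Nat.cast_injective hij)
  · rw [Finset.card_univ, Fintype.card_fin]
    exact (Polynomial.mem_degreeLT.1 q.2).trans_le (by exact_mod_cast hmN)

lemma finrank_oddEll (s N : ℕ) : Module.finrank ℝ (OddEll s N) = N := by
  rw [(WithLp.linearEquiv _ ℝ (Fin N → ℝ)).finrank_eq, Module.finrank_fin_fun]

lemma finrank_quotient_polyEvalSubspace (s m : ℕ) :
    Module.finrank ℝ (OddEll s (2 * m) ⧸ polyEvalSubspace s m (2 * m)) = m := by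
  have h := (polyEvalSubspace s m (2 * m)).finrank_quotient_add_finrank
  rw [finrank_polyEvalSubspace s (by omega), finrank_oddEll] at h
  omega

/-- A vector with at most `m` nonzero entries that annihilates all value vectors of polynomials of
degree less than `m` is zero: test against the polynomial vanishing on all points of the support
but one. -/
lemma eq_zero_of_annihilates_polyEval {N m : ℕ} (c : Fin N → ℝ)
    (hc : ∀ q ∈ Polynomial.degreeLT ℝ m, ∑ i : Fin N, q.eval (i : ℝ) * c i = 0)
    (hcard : (Finset.univ.filter fun i => c i ≠ 0).card ≤ m) : c = 0 := by
  by_contra hne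
  obtain ⟨k, hk⟩ := Function.ne_iff.1 hne
  set T := Finset.univ.filter fun i => c i ≠ 0 with hT
  have hkT : k ∈ T := by simpa [hT] using hk
  let q : Polynomial ℝ := ∏ i ∈ T.erase k, (Polynomial.X - Polynomial.C ((i : ℕ) : ℝ))
  have hq : q ∈ Polynomial.degreeLT ℝ m := by
    have hlt := (Finset.card_erase_lt_of_mem hkT).trans_le hcard
    rw [Polynomial.mem_degreeLT, Polynomial.degree_prod]
    simpa only [Polynomial.degree_X_sub_C, Finset.sum_const, nsmul_one, Nat.cast_lt] using hlt
  have hsum := hc q hq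
  rw [Finset.sum_eq_single k] at hsum
  · rcases mul_eq_zero.1 hsum with h | h
    · rw [Polynomial.eval_prod, Finset.prod_eq_zero_iff] at h
      obtain ⟨i, hi, hik⟩ := h
      simp only [Polynomial.eval_sub, Polynomial.eval_X, Polynomial.eval_C, sub_eq_zero] at hik
      exact (Finset.mem_erase.1 hi).1 (Fin.ext (by exact_mod_cast hik.symm))
    · exact hk h
  · intro i _ hik
    by_cases hi : c i = 0
    · rw [hi, mul_zero]
    · rw [Polynomial.eval_prod, Finset.prod_eq_zero (i := i), zero_mul]
      · simp [hT, hik, hi]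
      · simp
  · simp

/-! ### Orthogonality in odd-exponent spaces -/

lemma OddEll.norm_pow (s N : ℕ) (x : OddEll s N) :
    ‖x‖ ^ (2 * s + 1) = ∑ i, |x i| ^ (2 * s + 1) := by
  have hp : 0 < ((2 * s + 1 : ℕ) : ℝ≥0∞).toReal := by
    rw [ENNReal.toReal_natCast]
    positivity
  rw [PiLp.norm_eq_sum hp, ENNReal.toReal_natCast, ← Real.rpow_natCast, ← Real.rpow_mul
    (Finset.sum_nonneg fun i _ => by positivity), one_div, inv_mul_cancel₀ (by positivity),
    Real.rpow_one]
  simp only [Real.rpow_natCast, Real.norm_eq_abs]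

/-- The first order condition for `x` to be a point of least norm of the line `x + ℝ e`. -/
lemma sum_mul_sgnPow_eq_zero_of_norm_le {s N : ℕ} (hs : s ≠ 0) (x e : OddEll s N)
    (h : ∀ t : ℝ, ‖x‖ ≤ ‖x - t • e‖) : ∑ i, e i * sgnPow s (x i) = 0 := by
  have hmin : IsLocalMin (fun t : ℝ => ∑ i, |x i - t * e i| ^ (2 * s + 1)) 0 := by
    refine Eventually.of_forall fun t => ?_
    have := pow_le_pow_left₀ (norm_nonneg x) (h t) (2 * s + 1)
    rw [OddEll.norm_pow, OddEll.norm_pow] at this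
    simpa using this
  have hder : HasDerivAt (fun t : ℝ => ∑ i, |x i - t * e i| ^ (2 * s + 1))
      (∑ i, (2 * s + 1 : ℕ) * sgnPow s (x i) * -(e i)) 0 := by
    refine HasDerivAt.fun_sum fun i _ => ?_
    have hin : HasDerivAt (fun t : ℝ => x i - t * e i) (-(e i)) 0 := by
      simpa using ((hasDerivAt_id (0 : ℝ)).mul_const (e i)).const_sub (x i)
    refine HasDerivAt.comp (0 : ℝ) (h₂ := fun y : ℝ => |y| ^ (2 * s + 1)) ?_ hin
    simpa using hasDerivAt_abs_pow_odd hs (x i)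
  have h0 := hmin.hasDerivAt_eq_zero hder
  have hfac : ∑ i, ((2 * s + 1 : ℕ) : ℝ) * sgnPow s (x i) * -(e i) =
      -((2 * s + 1 : ℕ) : ℝ) * ∑ i, e i * sgnPow s (x i) := by
    rw [Finset.mul_sum]
    exact Finset.sum_congr rfl fun i _ => by ring
  rw [hfac] at h0
  exact (mul_eq_zero.1 h0).resolve_left (neg_ne_zero.2 (by positivity))

/-- No subspace of dimension at least two is orthogonal to `polyEvalSubspace`; only `2s + 1 > 1`
matters for the exponent. -/
theorem not_isOrthogonalTo_polyEvalSubspace {s m : ℕ} (hs : s ≠ 0)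
    (L : Submodule ℝ (OddEll s (2 * m))) (hL : 2 ≤ Module.finrank ℝ L) :
    ¬ IsOrthogonalTo L (polyEvalSubspace s m (2 * m)) := by
  intro hort
  rw [isOrthogonalTo_iff] at hort
  obtain ⟨u, huL, v, hvL, hu, -, huv⟩ := exists_unit_pair_of_two_le_finrank L hL
  have hprop := mul_eq_mul_of_sgnPow_relations (s := s)
    {e | ∃ q ∈ Polynomial.degreeLT ℝ m, e = fun i : Fin (2 * m) => q.eval (i : ℝ)}
    (fun c hc hcard => eq_zero_of_annihilates_polyEval c (fun q hq => hc _ ⟨q, hq, rfl⟩) hcard)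
    u v (by
      rintro _ ⟨q, hq, rfl⟩ a b
      exact sum_mul_sgnPow_eq_zero_of_norm_le hs (a • u + b • v)
        (WithLp.toLp _ fun i : Fin (2 * m) => q.eval (i : ℝ)) fun t =>
          hort _ (L.add_mem (L.smul_mem a huL) (L.smul_mem b hvL)) _
            (Submodule.smul_mem _ t (mem_polyEvalSubspace hq)))
  obtain ⟨i, hi⟩ : ∃ i, u i ≠ 0 := by
    by_contra! hzero
    have : u = 0 := PiLp.ext hzero
    simp [this] at hu
  have hv : v - (v i / u i) • u = 0 := by
    ext j
    have := hprop i j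
    simp only [PiLp.sub_apply, PiLp.smul_apply, smul_eq_mul, PiLp.zero_apply]
    field_simp
    linarith
  have := huv (v i / u i)
  rw [hv, norm_zero] at this
  norm_num at this

/-! ### The direct sum -/

lemma norm_lsingle {α : Type*} {E : α → Type*} [∀ i, NormedAddCommGroup (E i)]
    [∀ i, NormedSpace ℝ (E i)] [DecidableEq α] (q : ℝ≥0∞) [Fact (1 ≤ q)] (i : α) (x : E i) :
    ‖lp.lsingle (𝕜 := ℝ) (E := E) q i x‖ = ‖x‖ :=
  lp.norm_single (zero_lt_one.trans_le Fact.out) i x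

lemma lsingle_injective {α : Type*} {E : α → Type*} [∀ i, NormedAddCommGroup (E i)]
    [∀ i, NormedSpace ℝ (E i)] [DecidableEq α] (q : ℝ≥0∞) [Fact (1 ≤ q)] (i : α) :
    Function.Injective (lp.lsingle (𝕜 := ℝ) (E := E) q i) :=
  (AddMonoidHomClass.isometry_of_norm _ (norm_lsingle q i)).injective

theorem mainTheorem5 :
    (∀ k m s : ℕ, 1 < k → k ≤ m → (m : ℤ) - (k : ℤ) + 2 < 2 * (s : ℤ) + 1 →
      ∃ E : Submodule ℝ (OddEll s (2 * m)),
        Module.finrank ℝ (OddEll s (2 * m) ⧸ E) = m ∧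
        ∀ L : Submodule ℝ (OddEll s (2 * m)),
          Module.finrank ℝ L = k → ¬ IsOrthogonalTo L E) ∧
    (∀ m s : ℕ, 2 ≤ m → m < 2 * s + 1 →
      ∃ E : Submodule ℝ (OddEll s (2 * m)),
        Module.finrank ℝ (OddEll s (2 * m) ⧸ E) = m ∧
        ∀ k : ℕ, 2 ≤ k → k ≤ m →
          ∀ L : Submodule ℝ (OddEll s (2 * m)),
            Module.finrank ℝ L = k → ¬ IsOrthogonalTo L E) ∧
    (∀ (q : ℝ≥0∞) [Fact (1 ≤ q)],
      ∃ (F E : ℕ+ → Submodule ℝ (OddEllSum q)) (ε : ℕ+ → ℝ),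
        (∀ m : ℕ+, F m = oddEllSummand q m) ∧
        (∀ m : ℕ+, FiniteDimensional ℝ (F m)) ∧
        (∀ m : ℕ+, E m ≤ F m) ∧
        (∀ m : ℕ+, Module.finrank ℝ (F m) = Module.finrank ℝ (E m) + (m : ℕ)) ∧
        (∀ m : ℕ+, 0 < ε m) ∧
        Tendsto ε atTop (𝓝 0) ∧
        ∀ (m : ℕ+) (K : Submodule ℝ (OddEllSum q)),
          K ≤ F m → 2 ≤ Module.finrank ℝ K → ¬ IsAlmostOrthogonalTo (ε m) K (E m)) := by
  refine ⟨fun k m s hk hkm hs => ?_, fun m s hm hs => ?_, fun q _ => ?_⟩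
  · exact ⟨polyEvalSubspace s m (2 * m), finrank_quotient_polyEvalSubspace s m, fun L hL =>
      not_isOrthogonalTo_polyEvalSubspace (by omega) L (by omega)⟩
  · exact ⟨polyEvalSubspace s m (2 * m), finrank_quotient_polyEvalSubspace s m,
      fun k hk _ L hL => not_isOrthogonalTo_polyEvalSubspace (by omega) L (by omega)⟩
  · choose ε hε hK using fun m : ℕ+ => exists_pos_forall_not_isAlmostOrthogonalTo
      (polyEvalSubspace m m (2 * m)) (not_isOrthogonalTo_polyEvalSubspace m.ne_zero)
    -- Decreasing `ε m` keeps the conclusion, so it may be taken below `1 / m`.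
    refine ⟨oddEllSummand q, fun m => (polyEvalSubspace m m (2 * m)).map
        (lp.lsingle (𝕜 := ℝ) (E := fun m : ℕ+ => OddEll (m : ℕ) (2 * (m : ℕ))) q m),
      fun m => min (ε m) (1 / (m : ℝ)), fun _ => rfl, fun m => ?_, fun m => ?_, fun m => ?_,
      fun m => ?_, ?_, fun m K hKF hK2 hKE => ?_⟩
    · rw [oddEllSummand]
      infer_instance
    · exact LinearMap.map_le_range
    · rw [oddEllSummand, LinearMap.finrank_range_of_inj (lsingle_injective q m),
        ← (Submodule.equivMapOfInjective _ (lsingle_injective q m) _).finrank_eq,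
        finrank_polyEvalSubspace _ (by omega), finrank_oddEll]
      omega
    · exact lt_min (hε m) (by positivity)
    · have hlim : Tendsto (fun m : ℕ+ => 1 / ((m : ℕ) : ℝ)) atTop (𝓝 0) :=
        tendsto_one_div_atTop_nhds_zero_nat.comp tendsto_PNat_val_atTop_atTop
      exact squeeze_zero (fun m => le_min (hε m).le (by positivity)) (fun m => min_le_right _ _)
        hlim
    · exact not_isAlmostOrthogonalTo_map
        (norm_lsingle (E := fun m : ℕ+ => OddEll (m : ℕ) (2 * (m : ℕ))) q m) (hK m) hKF hK2
        (hKE.mono (min_le_left _ _))
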